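/- Let $(\Omega,\mathcal F,\mathbb P)$ be a complete probability space, $\vartheta:\Omega\to\Omega$ a measurable $\mathbb P$-preserving map, and $X$ a compact metric space with Borel $\sigma$-algebra $\mathcal B$. Let $\mathcal E\in\mathcal F\otimes\mathcal B$ be such that all fibres $\mathcal E_\omega=\{x\in X:(\omega,x)\in\mathcal E\}$ are nonempty and compact. Let $T$ be a continuous bundle random dynamical system on $\mathcal E$, i.e. a family of maps $T_\omega:\mathcal E_\omega\to\mathcal E_{\vartheta\omega}$ ($\omega\in\Omega$) such that $(\omega,x)\mapsto T_\omega x$ is measurable on $\mathcal E$ and $x\mapsto T_\omega x$ is continuous on $\mathcal E_\omega$ for $\mathbb P$-a.e. $\omega$. Put $T^0_\omega=\mathrm{id}$ and $T^n_\omega=T_{\vartheta^{n-1}\omega}\circ\cdots\circ T_{\vartheta\omega}\circ T_\omega$. For a cover $\alpha$ of a nonempty compact space $K$ by finitely many open sets let $\mathcal D(\alpha)=\min_\beta\bigl(-1+\sup_{x\in K}\sum_{V\in\beta}1_V(x)\bigr)$, where $\beta$ runs over the finite open covers of $K$ refining $\alpha$. For a finite open cover $\alpha$ of $X$ let $\alpha_0^{n-1}(\omega|\mathcal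 E)$ be the cover of $\mathcal E_\omega$ by the sets $\{x\in\mathcal E_\omega: T^i_\omega x\in A_i,\ 0\le i<n\}$ with $A_0,\dots,A_{n-1}\in\alpha$; it is open for $\mathbb P$-a.e. $\omega$. Let $$\mathrm{mdim}(T)=\sup_\alpha\ \lim_{n\to\infty}\frac1n\int_\Omega\mathcal D\bigl(\alpha_0^{n-1}(\omega|\mathcal E)\bigr)\,d\mathbb P(\omega),$$ the supremum being over all finite open covers $\alpha$ of $X$. A Borel set $E\subset X$ is called small if $\lim_{n\to\infty}\frac1n\sup_{x\in\mathcal E_\omega}\sum_{i=0}^{n-1}1_E(T^i_\omega x)=0$ for $\mathbb P$-a.e. $\omega$, and $T$ has the small boundary property if for every $x\in X$ and every open $U\ni x$ there is a neighbourhood $V\subset U$ of $x$ whose boundary $\partial V$ is small. **Theorem.** If $T$ has the small boundary property, then $\mathrm{mdim}(T)=0$. Moreover, for every finite open cover $\alpha$ of $X$ with $k$ elements and every $\epsilon>0$, for $\mathbb P$-a.e. $\omega$ there is $N_0$ such that $\mathcal D\bigl(\alpha_0^{N-1}(\omega|\mathcal E)\bigr)<\epsilon kN$ for all $N>N_0$.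 -/

import Mathlib

open MeasureTheory Filter Topology
open scoped ENNReal

noncomputable section

section Covers

variable {Y : Type*}

/-- A finite open cover of the space `Y`, as a finite collection of open sets. -/
def IsFiniteOpenCover [TopologicalSpace Y] (α : Set (Set Y)) : Prop :=
  α.Finite ∧ (∀ U ∈ α, IsOpen U) ∧ ⋃₀ α = Set.univ

/-- `β ≻ α`: every member of `β` lies in some member of `α`. -/
def CoverRefines (β α : Set (Set Y)) : Prop :=
  ∀ V ∈ β, ∃ U ∈ α, V ⊆ U

/-- `ord(β) = -1 + sup_x ∑_{U ∈ β} 1_U(x)`. For a cover of a nonempty space the supremum is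
at least `1`, so that the truncated subtraction is the usual one. -/
def coverOrd (β : Set (Set Y)) : ℕ∞ :=
  (⨆ x : Y, {U ∈ β | x ∈ U}.encard) - 1

/-- `𝒟(α)`: the minimum of `ord(β)` over all finite open covers `β` of `Y` that refine `α`. -/
def coverDim [TopologicalSpace Y] (α : Set (Set Y)) : ℕ∞ :=
  ⨅ (β : Set (Set Y)) (_ : IsFiniteOpenCover β ∧ CoverRefines β α), coverOrd β

end Covers

/-- A continuous bundle random dynamical system over `(Ω, P, ϑ)` with fibres in `X`. The fibre
maps `T_ω : 𝓔_ω → 𝓔_{ϑω}` are given by `step ω : X → X`, whose values off the fibre `𝓔_ω` are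
irrelevant: every condition, and everything defined below, looks at `step ω` on `𝓔_ω` only. -/
structure ContinuousBundleRDS {Ω : Type*} [MeasurableSpace Ω] (P : Measure Ω) (ϑ : Ω → Ω)
    (X : Type*) [MetricSpace X] [MeasurableSpace X] where
  /-- the bundle `𝓔 ⊆ Ω × X` -/
  bundle : Set (Ω × X)
  measurableSet_bundle : MeasurableSet bundle
  nonempty_fiber : ∀ ω, {x : X | (ω, x) ∈ bundle}.Nonempty
  isCompact_fiber : ∀ ω, IsCompact {x : X | (ω, x) ∈ bundle}
  /-- the fibre maps `T_ω` -/
  step : Ω → X → X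
  mapsTo_step : ∀ ω, Set.MapsTo (step ω) {x : X | (ω, x) ∈ bundle} {x : X | (ϑ ω, x) ∈ bundle}
  measurable_step : Measurable fun p : bundle => step p.1.1 p.1.2
  continuousOn_step : ∀ᵐ ω ∂P, ContinuousOn (step ω) {x : X | (ω, x) ∈ bundle}

namespace ContinuousBundleRDS

variable {Ω : Type*} [MeasurableSpace Ω] {P : Measure Ω} {ϑ : Ω → Ω}
  {X : Type*} [MetricSpace X] [MeasurableSpace X]

/-- The fibre `𝓔_ω`. -/
def fiber (T : ContinuousBundleRDS P ϑ X) (ω : Ω) : Set X :=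
  {x : X | (ω, x) ∈ T.bundle}

/-- `T_ω^n = T_{ϑ^{n-1}ω} ∘ ⋯ ∘ T_{ϑω} ∘ T_ω`, with `T_ω^0 = id`. -/
def iter (T : ContinuousBundleRDS P ϑ X) : ℕ → Ω → X → X
  | 0, _, x => x
  | n + 1, ω, x => T.step (ϑ^[n] ω) (T.iter n ω x)

/-- `α_0^{n-1}(ω|𝓔)`: the cover of the fibre `𝓔_ω` by the sets
`{x ∈ 𝓔_ω | T_ω^i x ∈ j_i for 0 ≤ i < n}`, where `j_0, …, j_{n-1}` run over `α`. -/
def joinCover (T : ContinuousBundleRDS P ϑ X) (α : Set (Set X)) (n : ℕ) (ω : Ω) :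
    Set (Set (T.fiber ω)) :=
  {A | ∃ j : Fin n → Set X, (∀ i, j i ∈ α) ∧
    A = {x : T.fiber ω | ∀ i : Fin n, T.iter i ω (x : X) ∈ j i}}

/-- `mdim(T, α) = lim_n (1/n) 𝔼 𝒟(α_0^{n-1}(ω|𝓔))`. The expectations form a subadditive sequence,
so the limit exists and is equal to the limit superior. -/
def mdimCover (T : ContinuousBundleRDS P ϑ X) (α : Set (Set X)) : ℝ≥0∞ :=
  limsup (fun n : ℕ => (∫⁻ ω, ((coverDim (T.joinCover α n ω) : ℕ∞) : ℝ≥0∞) ∂P) / (n : ℝ≥0∞)) atTop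

/-- The mean topological dimension: the supremum of `mdim(T, α)` over all finite open covers `α`
of `X`. -/
def mdim (T : ContinuousBundleRDS P ϑ X) : ℝ≥0∞ :=
  ⨆ (α : Set (Set X)) (_ : IsFiniteOpenCover α), T.mdimCover α

/-- The `ω`-orbit capacity `lim_n (1/n) sup_{x ∈ 𝓔_ω} ∑_{i < n} 1_E(T_ω^i x)`. The limit exists for
almost all `ω` by subadditivity; it is written as a limit superior, and it vanishes
exactly when the limit exists and is zero. -/
def orbitCapacity (T : ContinuousBundleRDS P ϑ X) (E : Set X) (ω : Ω) : ℝ≥0∞ :=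
  limsup (fun n : ℕ => (⨆ x ∈ T.fiber ω,
    ∑ i ∈ Finset.range n, E.indicator (fun _ => (1 : ℝ≥0∞)) (T.iter i ω x)) / (n : ℝ≥0∞)) atTop

/-- `E` is `T`-small: its `ω`-orbit capacity is zero for almost all `ω`. -/
def IsSmall (T : ContinuousBundleRDS P ϑ X) (E : Set X) : Prop :=
  ∀ᵐ ω ∂P, T.orbitCapacity E ω = 0

/-- The small boundary property. -/
def HasSBP (T : ContinuousBundleRDS P ϑ X) : Prop :=
  ∀ (x : X) (U : Set X), IsOpen U → x ∈ U → ∃ V ∈ 𝓝 x, V ⊆ U ∧ T.IsSmall (frontier V)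

end ContinuousBundleRDS

end

/-!
The dimension of a joined cover is bounded by mapping the fibre `𝓔_ω` to a skeleton of a cube.
By the small boundary property and compactness, `X` is covered by finitely many sets `V` with small
boundaries whose closures lie in members of `α`. Take a Urysohn function which is `1` on `V`, `0`
outside the member of `α`, and strictly between `0` and `1` only close to `∂V`. Evaluating these
functions at `x, T_ω x, …, T_ω^{N-1} x` maps `𝓔_ω` to a cube, and the number of fractional
coordinates of a point is at most its number of visits to neighbourhoods of the boundaries. If this
is at most `m` on all of `𝓔_ω`, then the open stars of the barycentric subdivision of the cube pull
back to a cover of order at most `m` (`coverDim_le_of_skeleton`). That it refines the joined cover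
is clear: in each star, at each time, some coordinate that belongs to that time is positive
throughout, because at every point some coordinate of that time is equal to `1`.

What remains is that a closed small set has, over almost every `ω`, a neighbourhood which orbits
visit with frequency at most `ε` (`ae_exists_visits_cthickening_le`). By compactness of
the fibres, for almost every `ω` there are a time `n` and a neighbourhood which all orbit segments
of length `n` starting over `ω` visit fewer than `ε n` times. Let `B j` be the set of those `ω` for
which no `n ≤ j` works with the neighbourhood of radius `1 / (j + 1)`. Cutting orbits into
such segments bounds the visits by `ε N` plus the visits of the base orbit to `B j`. As
`P (B j) → 0`, a maximal inequality shows that almost every base orbit visits one of the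
`B j` with small frequency (`ae_exists_baseVisits_lt`); this replaces the subadditive ergodic
theorem. The measurability of `B j` is an instance of the measurable projection theorem
(`measurableSet_image_fst`), which rests on the universal measurability of analytic sets and is
where completeness of `P` enters.

Without smallness, the same cube bounds the dimension by a constant times `N`, so that `mdim = 0`
follows from the pointwise statement by dominated convergence.
-/

/-! ### Measurable projection -/

/-- A continuous image of the Baire space has compact subsets of measure arbitrarily close to its
outer measure. The compact set is the image of a product of finite initial segments of `ℕ`, whose
lengths are chosen one coordinate at a time by continuity from below of the outer measure. -/
lemma exists_isCompact_subset_range_le_measure {α : Type*} [TopologicalSpace α]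
    [MeasurableSpace α] (μ : Measure α) [μ.OuterRegular]
    {f : (ℕ → ℕ) → α} (hf : Continuous f) {c : ℝ≥0∞} (hc : c < μ (Set.range f)) :
    ∃ K ⊆ Set.range f, IsCompact K ∧ c ≤ μ K := by
  have step : ∀ (k : ℕ) (A : Set (ℕ → ℕ)), ∃ m : ℕ,
      c < μ (f '' A) → c < μ (f '' (A ∩ {x | x k ≤ m})) := by
    intro k A
    by_cases h : c < μ (f '' A)
    · have hU : f '' A = ⋃ m : ℕ, f '' (A ∩ {x | x k ≤ m}) := by
        rw [← Set.image_iUnion, ← Set.inter_iUnion]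
        congr 1
        ext x
        simp only [Set.mem_inter_iff, Set.mem_iUnion, Set.mem_ofPred_eq]
        exact ⟨fun hx => ⟨hx, x k, le_rfl⟩, fun hx => hx.1⟩
      have hmono : Monotone fun m : ℕ => f '' (A ∩ {x | x k ≤ m}) := by
        intro m m' hm
        exact Set.image_mono (Set.inter_subset_inter_right _ fun x hx => le_trans hx hm)
      rw [hU, hmono.measure_iUnion] at h
      obtain ⟨m, hm⟩ := lt_iSup_iff.1 h
      exact ⟨m, fun _ => hm⟩
    · exact ⟨0, fun h' => absurd h' h⟩
  choose m hm using step
  let A : ℕ → Set (ℕ → ℕ) := fun k => Nat.rec Set.univ (fun k A => A ∩ {x | x k ≤ m k A}) k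
  have hA : ∀ k, c < μ (f '' A k) := by
    intro k
    induction k with
    | zero => simpa [A] using hc
    | succ k ih => exact hm k (A k) ih
  have hAn : ∀ k x, x ∈ A k → ∀ i < k, x i ≤ m i (A i) := by
    intro k
    induction k with
    | zero => intro x _ i hi; omega
    | succ k ih =>
      intro x hx i hi
      rcases Nat.lt_succ_iff_lt_or_eq.1 hi with h | rfl
      · exact ih x hx.1 i h
      · exact hx.2
  let K : Set (ℕ → ℕ) := Set.univ.pi fun i => Set.Iic (m i (A i))
  have hK : IsCompact K := isCompact_univ_pi fun i => (Set.finite_Iic _).isCompact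
  refine ⟨f '' K, Set.image_subset_range _ _, hK.image hf, ?_⟩
  rw [Set.measure_eq_iInf_isOpen (f '' K) μ]
  refine le_iInf₂ fun U hKU => le_iInf fun hU => ?_
  -- Some `A k` lies in `f ⁻¹' U`: truncating points of `A k` to `K` moves only far coordinates.
  have hex : ∃ k, f '' A k ⊆ U := by
    by_contra! hcon
    have : ∀ k, ∃ x ∈ A k, f x ∉ U := by
      intro k
      obtain ⟨_, ⟨x, hx, rfl⟩, hxU⟩ := Set.not_subset.1 (hcon k)
      exact ⟨x, hx, hxU⟩
    choose x hxA hxU using this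
    let y : ℕ → ℕ → ℕ := fun k i => min (x k i) (m i (A i))
    have hyK : ∀ k, y k ∈ K := fun k i _ => Set.mem_Iic.2 (min_le_right _ _)
    obtain ⟨z, hzK, hz⟩ := hK.ultrafilter_le_nhds ((hyperfilter ℕ).map y)
      (le_principal_iff.2 (mem_map.2 (Eventually.of_forall hyK)))
    have hyz : Tendsto y (hyperfilter ℕ) (𝓝 z) := hz
    have hxz : Tendsto x (hyperfilter ℕ) (𝓝 z) := by
      rw [tendsto_pi_nhds] at hyz ⊢
      intro i
      refine (hyz i).congr' ?_
      have : ∀ᶠ k in (hyperfilter ℕ : Filter ℕ), i < k :=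
        (Nat.hyperfilter_le_atTop) (eventually_gt_atTop i)
      filter_upwards [this] with k hk
      exact min_eq_left (hAn k _ (hxA k) i hk)
    have h1 : ∀ᶠ k in (hyperfilter ℕ : Filter ℕ), f (x k) ∈ U :=
      ((hf.tendsto z).comp hxz) (hU.mem_nhds (hKU ⟨z, hzK, rfl⟩))
    obtain ⟨k, hk⟩ := h1.exists
    exact hxU k hk
  obtain ⟨k, hk⟩ := hex
  exact (hA k).le.trans (measure_mono hk)

/-- Analytic sets are universally measurable. -/
lemma analyticSet_nullMeasurableSet {α : Type*} [TopologicalSpace α] [T2Space α]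
    [MeasurableSpace α] [BorelSpace α] (μ : Measure α) [IsFiniteMeasure μ] [μ.OuterRegular]
    {s : Set α} (hs : AnalyticSet s) : NullMeasurableSet s μ := by
  rcases (by simpa [AnalyticSet] using hs : s = ∅ ∨ ∃ f : (ℕ → ℕ) → α,
    Continuous f ∧ Set.range f = s) with rfl | ⟨f, hf, rfl⟩
  · exact MeasurableSet.empty.nullMeasurableSet
  by_cases h0 : μ (Set.range f) = 0
  · exact NullMeasurableSet.of_null h0
  obtain ⟨u, -, hu, hlim⟩ := exists_seq_strictMono_tendsto' (pos_iff_ne_zero.2 h0)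
  choose K hKs hK hle using fun n =>
    exists_isCompact_subset_range_le_measure μ hf (hu n).2
  have hm : MeasurableSet (⋃ n, K n) := MeasurableSet.iUnion fun n => (hK n).measurableSet
  refine hm.nullMeasurableSet.congr (ae_eq_of_subset_of_measure_ge (Set.iUnion_subset hKs) ?_
    hm.nullMeasurableSet (measure_ne_top _ _))
  exact le_of_tendsto' hlim fun n => (hle n).trans (measure_mono (Set.subset_iUnion K n))

/-- A measurable subset of a product is the pullback of a measurable subset of the product of a
Cantor space with the second factor: only countably many measurable sets of the first factor
enter its construction. -/
lemma exists_cantor_pullback {Ω X : Type*} [MeasurableSpace Ω] [MeasurableSpace X]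
    {A : Set (Ω × X)} (hA : MeasurableSet A) :
    ∃ (g : Ω → ℕ → Bool) (B : Set ((ℕ → Bool) × X)), Measurable g ∧ MeasurableSet B ∧
      A = {p | (g p.1, p.2) ∈ B} := by
  classical
  induction A, hA using MeasurableSpace.induction_on_inter generateFrom_prod.symm
    isPiSystem_prod with
  | empty => exact ⟨fun _ _ => true, ∅, measurable_const, MeasurableSet.empty, by simp⟩
  | basic t ht =>
    obtain ⟨s, hs, u, hu, rfl⟩ := ht
    refine ⟨fun ω _ => decide (ω ∈ s), {x | x 0 = true} ×ˢ u, ?_, ?_, ?_⟩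
    · refine measurable_pi_lambda _ fun _ => ?_
      exact measurable_to_bool (by simpa [Set.preimage] using hs)
    · exact (measurableSet_eq_fun (measurable_pi_apply 0) measurable_const).prod hu
    · ext p; simp
  | compl t _ ih =>
    obtain ⟨g, B, hg, hB, rfl⟩ := ih
    exact ⟨g, Bᶜ, hg, hB.compl, rfl⟩
  | iUnion t _ _ ih =>
    choose g B hg hB h using ih
    refine ⟨fun ω n => g n.unpair.1 ω n.unpair.2,
      ⋃ n, {p | ((fun k => p.1 (Nat.pair n k) : ℕ → Bool), p.2) ∈ B n}, ?_, ?_, ?_⟩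
    · exact measurable_pi_lambda _ fun n => (measurable_pi_apply _).comp (hg _)
    · refine MeasurableSet.iUnion fun n => ?_
      have : Measurable fun p : (ℕ → Bool) × X =>
          ((fun k => p.1 (Nat.pair n k) : ℕ → Bool), p.2) :=
        (measurable_pi_lambda _ fun k => (measurable_pi_apply _).comp measurable_fst).prodMk
          measurable_snd
      exact this (hB n)
    · ext p
      simp only [Set.mem_iUnion, Set.mem_ofPred_eq, Nat.unpair_pair]
      refine exists_congr fun n => ?_
      conv_lhs => rw [h n]
      rfl

/-- The **measurable projection theorem** over a complete finite measure space. -/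
lemma measurableSet_image_fst {Ω X : Type*} [MeasurableSpace Ω] (P : Measure Ω)
    [IsFiniteMeasure P] [P.IsComplete] [MeasurableSpace X] [StandardBorelSpace X]
    {A : Set (Ω × X)} (hA : MeasurableSet A) : MeasurableSet (Prod.fst '' A) := by
  obtain ⟨g, B, hg, hB, rfl⟩ := exists_cantor_pullback hA
  have himg : Prod.fst '' {p : Ω × X | (g p.1, p.2) ∈ B} = g ⁻¹' (Prod.fst '' B) := by
    ext ω; simp
  have han : AnalyticSet (Prod.fst '' B) := hB.analyticSet_image measurable_fst
  rw [himg]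
  exact ((analyticSet_nullMeasurableSet (P.map g) han).preimage
    (hg.measurePreserving P).quasiMeasurePreserving).measurable_of_complete

/-! ### A maximal inequality -/

/-- If from every time one can move on by at most `M` steps without gain, then all the partial
sums are bounded. -/
lemma sum_range_le_of_blocks {u : ℕ → ℝ} {M : ℕ} {K : ℝ} (hK : 0 ≤ K) (hu : ∀ t, u t ≤ K)
    (h : ∀ t, ∃ n, 1 ≤ n ∧ n ≤ M ∧ ∑ i ∈ Finset.range n, u (t + i) ≤ 0) (N : ℕ) :
    ∑ t ∈ Finset.range N, u t ≤ K * M := by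
  have key : ∀ N t, ∑ i ∈ Finset.range N, u (t + i) ≤ K * M := by
    intro N
    induction N using Nat.strong_induction_on with
    | _ N ih =>
      intro t
      rcases le_or_gt N M with hN | hN
      · calc ∑ i ∈ Finset.range N, u (t + i) ≤ ∑ _i ∈ Finset.range N, K :=
              Finset.sum_le_sum fun i _ => hu _
          _ = K * N := by simp [mul_comm]
          _ ≤ K * M := by gcongr
      · obtain ⟨n, hn1, hnM, hn⟩ := h t
        obtain ⟨r, rfl⟩ : ∃ r, N = n + r := ⟨N - n, by omega⟩
        rw [Finset.sum_range_add]
        have := ih r (by omega) (t + n)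
        simp only [← add_assoc]
        linarith
  simpa using key N 0

/-- The number of visits of the orbit of `ω` to `B` before time `n`. -/
noncomputable def baseVisits {Ω : Type*} (ϑ : Ω → Ω) (B : Set Ω) (n : ℕ) (ω : Ω) : ℝ :=
  ∑ i ∈ Finset.range n, B.indicator 1 (ϑ^[i] ω)

lemma measurable_baseVisits {Ω : Type*} [MeasurableSpace Ω] {ϑ : Ω → Ω} (hϑ : Measurable ϑ)
    {B : Set Ω} (hB : MeasurableSet B) (n : ℕ) : Measurable (baseVisits ϑ B n) :=
  Finset.measurable_fun_sum _ fun i _ => (measurable_one.indicator hB).comp (hϑ.iterate i)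

lemma integral_baseVisits {Ω : Type*} [MeasurableSpace Ω] {P : Measure Ω} [IsFiniteMeasure P]
    {ϑ : Ω → Ω} (hϑ : MeasurePreserving ϑ P P) {B : Set Ω} (hB : MeasurableSet B) (n : ℕ) :
    Integrable (baseVisits ϑ B n) P ∧ ∫ ω, baseVisits ϑ B n ω ∂P = n * P.real B := by
  have hint : ∀ i : ℕ, Integrable (fun ω => B.indicator (1 : Ω → ℝ) (ϑ^[i] ω)) P := fun i =>
    (hϑ.iterate i).integrable_comp_of_integrable
      ((integrable_const (1 : ℝ)).indicator hB)
  refine ⟨integrable_finsetSum _ fun i _ => hint i, ?_⟩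
  unfold baseVisits
  rw [integral_finsetSum _ fun i _ => hint i]
  have : ∀ i : ℕ, ∫ ω, B.indicator (1 : Ω → ℝ) (ϑ^[i] ω) ∂P = P.real B := by
    intro i
    have h1 : (fun ω => B.indicator (1 : Ω → ℝ) (ϑ^[i] ω))
        = (ϑ^[i] ⁻¹' B).indicator (1 : Ω → ℝ) := by
      ext ω
      by_cases h : ϑ^[i] ω ∈ B
      · rw [Set.indicator_of_mem h, Set.indicator_of_mem (Set.mem_preimage.2 h)]; rfl
      · rw [Set.indicator_of_notMem h, Set.indicator_of_notMem fun h' => h (Set.mem_preimage.1 h')]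
    rw [h1, integral_indicator_one ((hϑ.iterate i).measurable hB)]
    exact (hϑ.iterate i).measureReal_preimage hB.nullMeasurableSet
  simp [this]

/-- The **maximal inequality** for the visit frequencies of `B`. Orbits are cut into blocks on
which `B` has frequency at least `ε` whenever they meet the set on the left. -/
lemma measure_exists_le_baseVisits {Ω : Type*} [MeasurableSpace Ω] {P : Measure Ω}
    [IsFiniteMeasure P] {ϑ : Ω → Ω} (hϑ : MeasurePreserving ϑ P P) {B : Set Ω}
    (hB : MeasurableSet B) {ε : ℝ} (hε : 0 < ε) :
    P {ω | ∃ n : ℕ, 1 ≤ n ∧ ε * n ≤ baseVisits ϑ B n ω} ≤ P B / ENNReal.ofReal ε := by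
  let D : ℕ → Set Ω := fun M => {ω | ∃ n : ℕ, 1 ≤ n ∧ n ≤ M ∧ ε * n ≤ baseVisits ϑ B n ω}
  have hDU : {ω | ∃ n : ℕ, 1 ≤ n ∧ ε * n ≤ baseVisits ϑ B n ω} = ⋃ M, D M := by
    ext ω
    simp only [Set.mem_ofPred_eq, Set.mem_iUnion, D]
    exact ⟨fun ⟨n, h1, h2⟩ => ⟨n, n, h1, le_rfl, h2⟩, fun ⟨_, n, h1, _, h2⟩ => ⟨n, h1, h2⟩⟩
  have hDmono : Monotone D := fun M M' hM ω ⟨n, h1, h2, h3⟩ => ⟨n, h1, h2.trans hM, h3⟩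
  have hDmeas : ∀ M, MeasurableSet (D M) := by
    intro M
    have : D M = ⋃ n : ℕ, ⋃ (_ : 1 ≤ n ∧ n ≤ M), {ω | ε * n ≤ baseVisits ϑ B n ω} := by
      ext ω; simp [D, and_assoc]
    rw [this]
    exact MeasurableSet.iUnion fun n => MeasurableSet.iUnion fun _ =>
      measurableSet_le measurable_const (measurable_baseVisits hϑ.measurable hB n)
  have ind0 : ∀ (S : Set Ω) ω, 0 ≤ S.indicator (1 : Ω → ℝ) ω := fun S ω =>
    Set.indicator_nonneg (fun _ _ => zero_le_one) _
  have ind1 : ∀ (S : Set Ω) ω, S.indicator (1 : Ω → ℝ) ω ≤ 1 := fun S ω =>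
    Set.indicator_le_self' (fun _ _ => zero_le_one) _
  have hpt : ∀ M N ω, ε * baseVisits ϑ (D M) N ω ≤ baseVisits ϑ B N ω + ε * (M + 1) := by
    intro M N ω
    have := sum_range_le_of_blocks (u := fun t => ε * (D M).indicator 1 (ϑ^[t] ω)
      - B.indicator 1 (ϑ^[t] ω)) (M := M + 1) hε.le (fun t => by
        have h1 := ind1 (D M) (ϑ^[t] ω)
        have h2 := ind0 B (ϑ^[t] ω)
        nlinarith) (fun t => by
        by_cases ht : ϑ^[t] ω ∈ D M
        · obtain ⟨n, h1, h2, h3⟩ := ht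
          refine ⟨n, h1, by omega, ?_⟩
          rw [Finset.sum_sub_distrib, ← Finset.mul_sum]
          have h4 : ∑ i ∈ Finset.range n, (D M).indicator (1 : Ω → ℝ) (ϑ^[t + i] ω) ≤ n :=
            (Finset.sum_le_sum fun i _ => ind1 _ _).trans (by simp)
          have h5 : ∑ i ∈ Finset.range n, B.indicator (1 : Ω → ℝ) (ϑ^[t + i] ω)
              = baseVisits ϑ B n (ϑ^[t] ω) :=
            Finset.sum_congr rfl fun i _ => by rw [add_comm, Function.iterate_add_apply]
          rw [h5]
          nlinarith
        · refine ⟨1, le_rfl, by omega, ?_⟩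
          have h2 := ind0 B (ϑ^[t] ω)
          simpa [ht] using h2) N
    rw [Finset.sum_sub_distrib, ← Finset.mul_sum] at this
    push_cast at this
    unfold baseVisits
    linarith
  have hreal : ∀ M, ε * P.real (D M) ≤ P.real B := by
    intro M
    by_contra! hcon
    obtain ⟨N, hN⟩ := exists_nat_gt ((ε * (M + 1) * P.real Set.univ)
      / (ε * P.real (D M) - P.real B))
    rw [div_lt_iff₀ (by linarith)] at hN
    obtain ⟨hi1, he1⟩ := integral_baseVisits hϑ (hDmeas M) N
    obtain ⟨hi2, he2⟩ := integral_baseVisits hϑ hB N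
    have := integral_mono (hi1.const_mul ε) (hi2.add (integrable_const (ε * (M + 1))))
      (hpt M N)
    simp only [Pi.add_apply] at this
    rw [integral_const_mul, integral_add hi2 (integrable_const _), he1, he2, integral_const,
      smul_eq_mul] at this
    nlinarith
  rw [hDU, hDmono.measure_iUnion]
  refine iSup_le fun M => ?_
  rw [ENNReal.le_div_iff_mul_le (Or.inl (by simpa using hε)) (Or.inl ENNReal.ofReal_ne_top),
    ← ofReal_measureReal, ← ofReal_measureReal (s := B),
    ← ENNReal.ofReal_mul measureReal_nonneg]
  exact ENNReal.ofReal_le_ofReal (by linarith [hreal M])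

/-- If the measures of the sets `B j` tend to zero, then almost every orbit visits one of
these sets with small frequency. -/
lemma ae_exists_baseVisits_lt {Ω : Type*} [MeasurableSpace Ω] {P : Measure Ω}
    [IsFiniteMeasure P] {ϑ : Ω → Ω} (hϑ : MeasurePreserving ϑ P P) {B : ℕ → Set Ω}
    (hB : ∀ j, MeasurableSet (B j)) (hlim : Tendsto (fun j => P (B j)) atTop (𝓝 0))
    {ε : ℝ} (hε : 0 < ε) :
    ∀ᵐ ω ∂P, ∃ j, ∀ n : ℕ, 1 ≤ n → baseVisits ϑ (B j) n ω < ε * n := by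
  rw [ae_iff]
  have hlim' : Tendsto (fun j => P (B j) / ENNReal.ofReal ε) atTop (𝓝 0) := by
    simpa using ENNReal.Tendsto.div_const hlim (Or.inr (by simpa using hε))
  refine le_antisymm (ge_of_tendsto' hlim' fun j => ?_) zero_le
  refine (measure_mono fun ω hω => ?_).trans (measure_exists_le_baseVisits hϑ (hB j) hε)
  simp only [Set.mem_ofPred_eq, not_exists, not_forall, not_lt] at hω
  obtain ⟨n, h1, h2⟩ := hω j
  exact ⟨n, h1, h2⟩

/-! ### Covers from the barycentric subdivision of a cube -/

/-- The preimage under `g : Y → [0,1]^C` of an open star of the barycentric subdivision of the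
cube `[0,1]^C`: the coordinates in `S` are farther from `{0, 1}` than all the others,
and among the others those in `R` round to `1` and the rest round to `0`. -/
def cubeStar {Y C : Type*} (g : C → Y → ℝ) (S R : Finset C) : Set Y :=
  {y | (∀ c ∈ S, 0 < min (g c y) (1 - g c y) ∧
      ∀ c' ∉ S, min (g c' y) (1 - g c' y) < min (g c y) (1 - g c y)) ∧
    ∀ c ∉ S, (c ∈ R → 1 / 2 < g c y) ∧ (c ∉ R → g c y < 1 / 2)}

lemma mem_cubeStar {Y C : Type*} {g : C → Y → ℝ} {S R : Finset C} {y : Y} :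
    y ∈ cubeStar g S R ↔ (∀ c ∈ S, 0 < min (g c y) (1 - g c y) ∧
      ∀ c' ∉ S, min (g c' y) (1 - g c' y) < min (g c y) (1 - g c y)) ∧
    ∀ c ∉ S, (c ∈ R → 1 / 2 < g c y) ∧ (c ∉ R → g c y < 1 / 2) := Iff.rfl

lemma isOpen_cubeStar {Y C : Type*} [TopologicalSpace Y] [Finite C] {g : C → Y → ℝ}
    (hg : ∀ c, Continuous (g c)) (S R : Finset C) : IsOpen (cubeStar g S R) := by
  have hd : ∀ c, Continuous fun y => min (g c y) (1 - g c y) := fun c =>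
    (hg c).min (continuous_const.sub (hg c))
  have : cubeStar g S R = (⋂ c, ⋂ (_ : c ∈ S), ({y | 0 < min (g c y) (1 - g c y)} ∩
      ⋂ c', ⋂ (_ : c' ∉ S), {y | min (g c' y) (1 - g c' y) < min (g c y) (1 - g c y)})) ∩
      ⋂ c, ⋂ (_ : c ∉ S), ((⋂ (_ : c ∈ R), {y | 1 / 2 < g c y}) ∩
        ⋂ (_ : c ∉ R), {y | g c y < 1 / 2}) := by
    ext y
    simp only [mem_cubeStar, Set.mem_inter_iff, Set.mem_iInter, Set.mem_ofPred_eq]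
  rw [this]
  refine IsOpen.inter (isOpen_iInter_of_finite fun c => isOpen_iInter_of_finite fun _ =>
    (isOpen_lt continuous_const (hd c)).inter (isOpen_iInter_of_finite fun c' =>
      isOpen_iInter_of_finite fun _ => isOpen_lt (hd c') (hd c))) ?_
  exact isOpen_iInter_of_finite fun c => isOpen_iInter_of_finite fun _ =>
    (isOpen_iInter_of_finite fun _ => isOpen_lt continuous_const (hg c)).inter
      (isOpen_iInter_of_finite fun _ => isOpen_lt (hg c) continuous_const)

/-- The sets `S` of the stars through a given point form a chain. -/
lemma cubeStar_eq_of_card_eq {Y C : Type*} {g : C → Y → ℝ} {S R S' R' : Finset C}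
    {y : Y} (h : y ∈ cubeStar g S R) (h' : y ∈ cubeStar g S' R') (hR : Disjoint S R)
    (hR' : Disjoint S' R') (hcard : S.card = S'.card) : S = S' ∧ R = R' := by
  have hS : S = S' := by
    by_cases h1 : S ⊆ S'
    · exact Finset.eq_of_subset_of_card_le h1 hcard.ge
    by_cases h2 : S' ⊆ S
    · exact (Finset.eq_of_subset_of_card_le h2 hcard.le).symm
    obtain ⟨c, hc, hc'⟩ := Finset.not_subset.1 h1
    obtain ⟨e, he, he'⟩ := Finset.not_subset.1 h2
    exact absurd ((h.1 c hc).2 e he') (((h'.1 e he).2 c hc').not_gt)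
  subst hS
  refine ⟨rfl, Finset.ext fun c => ?_⟩
  by_cases hc : c ∈ S
  · exact iff_of_false (Finset.disjoint_left.1 hR hc) (Finset.disjoint_left.1 hR' hc)
  · constructor <;> intro hcR <;> by_contra hcR'
    · exact absurd ((h.2 c hc).1 hcR) ((h'.2 c hc).2 hcR').not_gt
    · exact absurd ((h'.2 c hc).1 hcR) ((h.2 c hc).2 hcR').not_gt

/-- A map `g : Y → [0,1]^C` into the `m`-skeleton of the cube bounds `𝒟(α)` by `m`, provided that,
whenever a set `D` of coordinates contains all those equal to `1` at some point, the points at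
which all coordinates in `D` are positive lie in one member of `α`. -/
lemma coverDim_le_of_skeleton {Y C : Type*} [TopologicalSpace Y] [Fintype C]
    {g : C → Y → ℝ} (hg : ∀ c, Continuous (g c)) (h0 : ∀ c y, 0 ≤ g c y)
    (h1 : ∀ c y, g c y ≤ 1) {m : ℕ}
    (hm : ∀ y, (Finset.univ.filter fun c => 0 < min (g c y) (1 - g c y)).card ≤ m)
    {α : Set (Set Y)}
    (hα : ∀ D : Finset C, (∃ y, ∀ c, g c y = 1 → c ∈ D) →
      ∃ U ∈ α, ∀ y, (∀ c ∈ D, 0 < g c y) → y ∈ U) :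
    coverDim α ≤ m := by
  classical
  let β : Set (Set Y) := {U | U.Nonempty ∧
    ∃ S R : Finset C, Disjoint S R ∧ U = cubeStar g S R}
  have hβ : IsFiniteOpenCover β := by
    refine ⟨?_, ?_, ?_⟩
    · refine (Set.finite_range fun p : Finset C × Finset C => cubeStar g p.1 p.2).subset ?_
      rintro U ⟨-, S, R, -, rfl⟩
      exact ⟨(S, R), rfl⟩
    · rintro U ⟨-, S, R, -, rfl⟩
      exact isOpen_cubeStar hg S R
    · refine Set.eq_univ_of_forall fun y => ?_
      let S : Finset C := Finset.univ.filter fun c => 0 < min (g c y) (1 - g c y)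
      let R : Finset C := Finset.univ.filter fun c => g c y = 1
      have hy : y ∈ cubeStar g S R := by
        refine ⟨fun c hc => ?_, fun c hc => ?_⟩
        · have hc' : 0 < min (g c y) (1 - g c y) := (Finset.mem_filter.1 hc).2
          refine ⟨hc', fun c' hc'' => ?_⟩
          have : ¬ 0 < min (g c' y) (1 - g c' y) := fun h => hc'' (by simpa [S] using h)
          exact (not_lt.1 this).trans_lt hc'
        · have : ¬ 0 < min (g c y) (1 - g c y) := fun h => hc (by simpa [S] using h)
          have h01 : g c y = 0 ∨ g c y = 1 := by
            rcases min_le_iff.1 (not_lt.1 this) with h | h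
            · exact Or.inl (le_antisymm h (h0 c y))
            · exact Or.inr (le_antisymm (h1 c y) (by linarith))
          simp only [R, Finset.mem_filter, Finset.mem_univ, true_and]
          rcases h01 with h | h <;> rw [h] <;> norm_num
      refine ⟨cubeStar g S R, ⟨⟨y, hy⟩, S, R, ?_, rfl⟩, hy⟩
      refine Finset.disjoint_left.2 fun c hc hc' => ?_
      have h2 : 0 < min (g c y) (1 - g c y) := (Finset.mem_filter.1 hc).2
      rw [(Finset.mem_filter.1 hc').2] at h2
      simp at h2
  have href : CoverRefines β α := by
    rintro U ⟨⟨y, hy⟩, S, R, -, rfl⟩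
    obtain ⟨U, hU, hsub⟩ := hα (S ∪ R) ⟨y, fun c hc => by
      by_contra hcon
      rw [Finset.mem_union, not_or] at hcon
      have := (hy.2 c hcon.1).2 hcon.2
      linarith⟩
    refine ⟨U, hU, fun z hz => hsub z fun c hc => ?_⟩
    by_cases hcS : c ∈ S
    · exact (lt_min_iff.1 (hz.1 c hcS).1).1
    · have := (hz.2 c hcS).1 ((Finset.mem_union.1 hc).resolve_left hcS)
      linarith
  refine (iInf₂_le β ⟨hβ, href⟩).trans ?_
  rw [coverOrd, tsub_le_iff_right]
  refine iSup_le fun y => ?_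
  -- The stars through `y` are distinguished by the cardinality of `S`, which is at most `m`.
  have hex : ∀ U ∈ {U ∈ β | y ∈ U}, ∃ p : Finset C × Finset C, Disjoint p.1 p.2 ∧
      U = cubeStar g p.1 p.2 := by
    rintro U ⟨⟨-, S, R, h, rfl⟩, -⟩
    exact ⟨(S, R), h, rfl⟩
  choose! p hp hUp using hex
  have hmaps : Set.MapsTo (fun U => (p U).1.card) {U ∈ β | y ∈ U}
      (Finset.range (m + 1) : Set ℕ) := by
    intro U hU
    have hy : y ∈ cubeStar g (p U).1 (p U).2 := hUp U hU ▸ hU.2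
    rw [Finset.mem_coe, Finset.mem_range, Nat.lt_succ_iff]
    exact (Finset.card_le_card fun c hc => by simpa using (hy.1 c hc).1).trans (hm y)
  have hinj : Set.InjOn (fun U => (p U).1.card) {U ∈ β | y ∈ U} := by
    intro U hU U' hU' heq
    have hy : y ∈ cubeStar g (p U).1 (p U).2 := hUp U hU ▸ hU.2
    have hy' : y ∈ cubeStar g (p U').1 (p U').2 := hUp U' hU' ▸ hU'.2
    obtain ⟨h1, h2⟩ := cubeStar_eq_of_card_eq hy hy' (hp U hU) (hp U' hU') heq
    rw [hUp U hU, hUp U' hU', h1, h2]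
  refine (Set.encard_le_encard_of_injOn hmaps hinj).trans ?_
  rw [Set.encard_coe_eq_coe_finsetCard, Finset.card_range]
  push_cast
  exact le_rfl

/-! ### Orbits of the bundle system -/

namespace ContinuousBundleRDS

lemma iter_mem_fiber {Ω : Type*} [MeasurableSpace Ω] {P : Measure Ω} {ϑ : Ω → Ω} {X : Type*}
    [MetricSpace X] [MeasurableSpace X] (T : ContinuousBundleRDS P ϑ X) (n : ℕ) {ω : Ω} {x : X}
    (hx : x ∈ T.fiber ω) : T.iter n ω x ∈ T.fiber (ϑ^[n] ω) := by
  induction n with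
  | zero => exact hx
  | succ n ih =>
    rw [Function.iterate_succ_apply']
    exact T.mapsTo_step _ ih

lemma iter_add {Ω : Type*} [MeasurableSpace Ω] {P : Measure Ω} {ϑ : Ω → Ω} {X : Type*}
    [MetricSpace X] [MeasurableSpace X] (T : ContinuousBundleRDS P ϑ X) (m n : ℕ) (ω : Ω) (x : X) :
    T.iter (m + n) ω x = T.iter n (ϑ^[m] ω) (T.iter m ω x) := by
  induction n with
  | zero => rfl
  | succ n ih =>
    rw [← add_assoc, iter, iter, ih, ← Function.iterate_add_apply, add_comm n m]

lemma measurable_iter {Ω : Type*} [MeasurableSpace Ω] {P : Measure Ω} {ϑ : Ω → Ω}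
    {X : Type*} [MetricSpace X] [MeasurableSpace X] (T : ContinuousBundleRDS P ϑ X)
    (hϑ : Measurable ϑ) (n : ℕ) : Measurable fun p : T.bundle => T.iter n p.1.1 p.1.2 := by
  -- `T^n_ω x` is the second component of the `n`-th iterate of the skew product on the bundle.
  have hskew : Measurable fun p : T.bundle =>
      (⟨(ϑ p.1.1, T.step p.1.1 p.1.2), T.mapsTo_step p.1.1 p.2⟩ : T.bundle) :=
    ((hϑ.comp (measurable_fst.comp measurable_subtype_coe)).prodMk
      T.measurable_step).subtype_mk
  have hiter : ∀ (n : ℕ) (p : T.bundle), ((fun p : T.bundle =>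
      (⟨(ϑ p.1.1, T.step p.1.1 p.1.2), T.mapsTo_step p.1.1 p.2⟩ : T.bundle))^[n] p : Ω × X)
        = (ϑ^[n] p.1.1, T.iter n p.1.1 p.1.2) := by
    intro n p
    induction n with
    | zero => rfl
    | succ n ih => simp only [Function.iterate_succ_apply', ih, iter]
  have := measurable_snd.comp (measurable_subtype_coe.comp (hskew.iterate n))
  convert this using 2 with p
  exact (congrArg Prod.snd (hiter n p)).symm

lemma ae_continuousOn_iter {Ω : Type*} [MeasurableSpace Ω] {P : Measure Ω} {ϑ : Ω → Ω}
    {X : Type*} [MetricSpace X] [MeasurableSpace X] (T : ContinuousBundleRDS P ϑ X)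
    (hϑ : MeasurePreserving ϑ P P) :
    ∀ᵐ ω ∂P, ∀ n, ContinuousOn (T.iter n ω) (T.fiber ω) := by
  have h : ∀ᵐ ω ∂P, ∀ n : ℕ, ContinuousOn (T.step (ϑ^[n] ω)) (T.fiber (ϑ^[n] ω)) :=
    ae_all_iff.2 fun n => (hϑ.iterate n).quasiMeasurePreserving.ae T.continuousOn_step
  filter_upwards [h] with ω hω n
  induction n with
  | zero => exact continuousOn_id
  | succ n ih => exact (hω n).comp ih fun x hx => T.iter_mem_fiber n hx

/-- The number of visits of the orbit of `(ω, x)` to `E` before time `n`. -/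
noncomputable def visits {Ω : Type*} [MeasurableSpace Ω] {P : Measure Ω} {ϑ : Ω → Ω} {X : Type*}
    [MetricSpace X] [MeasurableSpace X] (T : ContinuousBundleRDS P ϑ X) (E : Set X) (n : ℕ)
    (ω : Ω) (x : X) : ℝ :=
  ∑ i ∈ Finset.range n, E.indicator 1 (T.iter i ω x)

lemma visits_mono {Ω : Type*} [MeasurableSpace Ω] {P : Measure Ω} {ϑ : Ω → Ω} {X : Type*}
    [MetricSpace X] [MeasurableSpace X] (T : ContinuousBundleRDS P ϑ X) {E F : Set X} (h : E ⊆ F)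
    (n : ℕ) (ω : Ω) (x : X) : T.visits E n ω x ≤ T.visits F n ω x :=
  Finset.sum_le_sum fun _ _ => Set.indicator_le_indicator_of_subset h (fun _ => zero_le_one) _

lemma exists_visits_lt_of_orbitCapacity_eq_zero {Ω : Type*} [MeasurableSpace Ω] {P : Measure Ω}
    {ϑ : Ω → Ω} {X : Type*} [MetricSpace X] [MeasurableSpace X] (T : ContinuousBundleRDS P ϑ X)
    {E : Set X} {ω : Ω} (h : T.orbitCapacity E ω = 0) {ε : ℝ} (hε : 0 < ε) :
    ∃ n : ℕ, 1 ≤ n ∧ ∀ x ∈ T.fiber ω, T.visits E n ω x < ε * n := by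
  have hlt : T.orbitCapacity E ω < ENNReal.ofReal ε := by
    rw [h]; exact ENNReal.ofReal_pos.2 hε
  obtain ⟨n, hn, hn1⟩ := ((eventually_lt_of_limsup_lt hlt).and (eventually_ge_atTop 1)).exists
  refine ⟨n, hn1, fun x hx => ?_⟩
  have hpos : (0 : ℝ) < n := by exact_mod_cast hn1
  rw [ENNReal.div_lt_iff (Or.inl (by simp; omega))
    (Or.inl (ENNReal.natCast_ne_top n))] at hn
  have h1 : ∑ i ∈ Finset.range n, E.indicator (fun _ => (1 : ℝ≥0∞)) (T.iter i ω x)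
      = ENNReal.ofReal (T.visits E n ω x) := by
    rw [visits, ENNReal.ofReal_sum_of_nonneg
      (f := fun i => E.indicator (1 : X → ℝ) (T.iter i ω x))
      fun i _ => Set.indicator_nonneg (fun _ _ => zero_le_one) _]
    refine Finset.sum_congr rfl fun i _ => ?_
    by_cases hi : T.iter i ω x ∈ E
    · rw [Set.indicator_of_mem hi, Set.indicator_of_mem hi]; simp
    · rw [Set.indicator_of_notMem hi, Set.indicator_of_notMem hi]; simp
  have h2 := (le_iSup₂ (f := fun x (_ : x ∈ T.fiber ω) =>
    ∑ i ∈ Finset.range n, E.indicator (fun _ => (1 : ℝ≥0∞)) (T.iter i ω x)) x hx).trans_lt hn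
  rw [h1, ← ENNReal.ofReal_natCast n, ← ENNReal.ofReal_mul hε.le] at h2
  exact (ENNReal.ofReal_lt_ofReal_iff (by positivity)).1 h2

lemma _root_.IsClosed.exists_notMem_cthickening {X : Type*} [MetricSpace X] {E : Set X}
    (hE : IsClosed E) {x : X} (hx : x ∉ E) :
    ∃ j : ℕ, x ∉ Metric.cthickening (1 / ((j : ℝ) + 1)) E := by
  have hpos : 0 < Metric.infEDist x E := by
    rw [pos_iff_ne_zero]
    exact fun h => hx (hE.closure_eq ▸ Metric.mem_closure_iff_infEDist_zero.2 h)
  have hlim : Tendsto (fun j : ℕ => ENNReal.ofReal (1 / ((j : ℝ) + 1))) atTop (𝓝 0) := by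
    simpa using ENNReal.tendsto_ofReal tendsto_one_div_add_atTop_nhds_zero_nat
  obtain ⟨j, hj⟩ := (hlim.eventually_lt_const hpos).exists
  exact ⟨j, fun h => (Metric.mem_cthickening_iff.1 h).not_gt hj⟩

/-- Upper semicontinuity: a strict bound, uniform on the fibre, for the visits to a closed set
persists for the visits to a small neighbourhood of it. -/
lemma exists_visits_cthickening_lt {Ω : Type*} [MeasurableSpace Ω] {P : Measure Ω}
    {ϑ : Ω → Ω} {X : Type*} [MetricSpace X] [MeasurableSpace X] (T : ContinuousBundleRDS P ϑ X)
    {E : Set X} (hE : IsClosed E) {ω : Ω} (hω : ∀ n, ContinuousOn (T.iter n ω) (T.fiber ω))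
    {n : ℕ} {c : ℝ} (h : ∀ x ∈ T.fiber ω, T.visits E n ω x < c) :
    ∃ j : ℕ, ∀ x ∈ T.fiber ω, T.visits (Metric.cthickening (1 / ((j : ℝ) + 1)) E) n ω x < c := by
  by_contra! hcon
  choose x hx hxc using hcon
  obtain ⟨z, hz, hxz⟩ := (T.isCompact_fiber ω).ultrafilter_le_nhds ((hyperfilter ℕ).map x)
    (le_principal_iff.2 (mem_map.2 (Eventually.of_forall hx)))
  have hxz' : Tendsto x (hyperfilter ℕ) (𝓝[T.fiber ω] z) :=
    tendsto_nhdsWithin_iff.2 ⟨hxz, Eventually.of_forall hx⟩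
  have hev : ∀ i, ∀ᶠ j : ℕ in (hyperfilter ℕ : Filter ℕ),
      (Metric.cthickening (1 / ((j : ℝ) + 1)) E).indicator (1 : X → ℝ) (T.iter i ω (x j))
        ≤ E.indicator 1 (T.iter i ω z) := by
    intro i
    by_cases hi : T.iter i ω z ∈ E
    · rw [Set.indicator_of_mem hi]
      exact Eventually.of_forall fun j => Set.indicator_le_self' (fun _ _ => zero_le_one) _
    · obtain ⟨j₀, hj₀⟩ := hE.exists_notMem_cthickening hi
      have hnhds : (Metric.cthickening (1 / ((j₀ : ℝ) + 1)) E)ᶜ ∈ 𝓝 (T.iter i ω z) :=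
        Metric.isClosed_cthickening.isOpen_compl.mem_nhds hj₀
      have htend : Tendsto (fun j => T.iter i ω (x j)) (hyperfilter ℕ) (𝓝 (T.iter i ω z)) :=
        (hω i z hz).tendsto.comp hxz'
      filter_upwards [htend hnhds, Nat.hyperfilter_le_atTop (eventually_ge_atTop j₀)]
        with j hj hjj
      rw [Set.indicator_of_notMem hi, Set.indicator_of_notMem]
      refine fun hmem => hj (Metric.cthickening_mono ?_ _ hmem)
      gcongr
  obtain ⟨j, hj⟩ := ((eventually_all_finset (Finset.range n)).2 fun i _ => hev i).exists
  exact ((hxc j).trans (Finset.sum_le_sum hj)).not_gt (h z hz)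

/-- The set of base points over which some orbit visits `E` at least `c` times is an
instance of measurable projection. -/
lemma measurableSet_exists_le_visits {Ω : Type*} [MeasurableSpace Ω] {P : Measure Ω}
    [IsFiniteMeasure P] [P.IsComplete] {ϑ : Ω → Ω} {X : Type*} [MetricSpace X] [CompactSpace X]
    [MeasurableSpace X] [BorelSpace X] (T : ContinuousBundleRDS P ϑ X) (hϑ : Measurable ϑ)
    {E : Set X} (hE : MeasurableSet E) (n : ℕ) (c : ℝ) :
    MeasurableSet {ω | ∃ x ∈ T.fiber ω, c ≤ T.visits E n ω x} := by
  have hm : Measurable fun p : T.bundle => T.visits E n p.1.1 p.1.2 :=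
    Finset.measurable_fun_sum _ fun i _ =>
      (measurable_one.indicator hE).comp (T.measurable_iter hϑ i)
  have hA : MeasurableSet ((↑) '' {p : T.bundle | c ≤ T.visits E n p.1.1 p.1.2} : Set (Ω × X)) :=
    T.measurableSet_bundle.subtype_image (measurableSet_le measurable_const hm)
  convert measurableSet_image_fst P hA using 1
  ext ω
  simp only [Set.mem_ofPred_eq, Set.mem_image, Subtype.exists, Prod.exists]
  constructor
  · rintro ⟨x, hx, hc⟩
    exact ⟨ω, x, ⟨ω, x, hx, hc, rfl⟩, rfl⟩
  · rintro ⟨_, x, ⟨ω', x', hx, hc, h⟩, rfl⟩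
    cases h
    exact ⟨_, hx, hc⟩

/-- A closed small set has, over almost every `ω`, a neighbourhood of arbitrarily small orbit
capacity. The radius depends on `ω`, as no ergodicity is assumed. -/
lemma ae_exists_visits_cthickening_le {Ω : Type*} [MeasurableSpace Ω] {P : Measure Ω}
    [IsProbabilityMeasure P] [P.IsComplete] {ϑ : Ω → Ω} (hϑ : MeasurePreserving ϑ P P)
    {X : Type*} [MetricSpace X] [CompactSpace X] [MeasurableSpace X] [BorelSpace X]
    (T : ContinuousBundleRDS P ϑ X) {E : Set X} (hE : IsClosed E) (hsmall : T.IsSmall E)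
    {ε : ℝ} (hε : 0 < ε) :
    ∀ᵐ ω ∂P, ∃ δ > 0, ∃ N₀ : ℕ, ∀ N : ℕ, N₀ < N → ∀ x ∈ T.fiber ω,
      T.visits (Metric.cthickening δ E) N ω x ≤ ε * N := by
  let F : ℕ → Set X := fun j => Metric.cthickening (1 / ((j : ℝ) + 1)) E
  have hF : Antitone F := fun j j' hj => Metric.cthickening_mono (by gcongr) _
  set η := ε / 3 with hη
  have hη0 : 0 < η := by positivity
  -- Outside `B j`, orbits can be cut off after at most `j` steps with few visits to `F j`.
  let B : ℕ → Set Ω := fun j => {ω | ∀ n : ℕ, 1 ≤ n → n ≤ j →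
    ∃ x ∈ T.fiber ω, η * n ≤ T.visits (F j) n ω x}
  have hBmeas : ∀ j, MeasurableSet (B j) := by
    intro j
    have : B j = ⋂ n : ℕ, ⋂ (_ : 1 ≤ n), ⋂ (_ : n ≤ j),
        {ω | ∃ x ∈ T.fiber ω, η * n ≤ T.visits (F j) n ω x} := by
      ext ω; simp only [B, Set.mem_ofPred_eq, Set.mem_iInter]
    rw [this]
    exact MeasurableSet.iInter fun n => MeasurableSet.iInter fun _ => MeasurableSet.iInter fun _ =>
      T.measurableSet_exists_le_visits hϑ.measurable Metric.isClosed_cthickening.measurableSet n _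
  have hBanti : Antitone B := by
    intro j j' hj ω hω n h1 h2
    obtain ⟨x, hx, hc⟩ := hω n h1 (h2.trans hj)
    exact ⟨x, hx, hc.trans (T.visits_mono (hF hj) _ _ _)⟩
  have hBnull : P (⋂ j, B j) = 0 := by
    refine measure_mono_null (t := {ω | ¬ (T.orbitCapacity E ω = 0 ∧
      ∀ n, ContinuousOn (T.iter n ω) (T.fiber ω))}) ?_
      (ae_iff.1 (hsmall.and (T.ae_continuousOn_iter hϑ)))
    rintro ω hω ⟨h0, hcont⟩
    obtain ⟨n, hn1, hn⟩ := T.exists_visits_lt_of_orbitCapacity_eq_zero h0 hη0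
    obtain ⟨j, hj⟩ := T.exists_visits_cthickening_lt hE hcont hn
    obtain ⟨x, hx, hc⟩ := Set.mem_iInter.1 hω (max n j) n hn1 (le_max_left _ _)
    exact ((hc.trans (T.visits_mono (hF (le_max_right n j)) _ _ _)).trans_lt (hj x hx)).false
  have hlim : Tendsto (fun j => P (B j)) atTop (𝓝 0) := by
    rw [← hBnull]
    exact tendsto_measure_iInter_atTop (fun j => (hBmeas j).nullMeasurableSet) hBanti
      ⟨0, measure_ne_top _ _⟩
  filter_upwards [ae_exists_baseVisits_lt hϑ hBmeas hlim hη0] with ω ⟨j, hj⟩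
  obtain ⟨N₀, hN₀⟩ := exists_nat_gt (((j : ℝ) + 1) / η)
  rw [div_lt_iff₀ hη0] at hN₀
  refine ⟨1 / ((j : ℝ) + 1), by positivity, N₀, fun N hN x hx => ?_⟩
  have ind0 : ∀ t, 0 ≤ (B j).indicator (1 : Ω → ℝ) (ϑ^[t] ω) := fun t =>
    Set.indicator_nonneg (fun _ _ => zero_le_one) _
  have ind1 : ∀ t, (F j).indicator (1 : X → ℝ) (T.iter t ω x) ≤ 1 := fun t =>
    Set.indicator_le_self' (fun _ _ => zero_le_one) _
  have key := sum_range_le_of_blocks (u := fun t => (F j).indicator 1 (T.iter t ω x) - η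
    - (B j).indicator 1 (ϑ^[t] ω)) (M := j + 1) zero_le_one
    (fun t => by linarith [ind0 t, ind1 t]) (fun t => by
      by_cases ht : ϑ^[t] ω ∈ B j
      · refine ⟨1, le_rfl, by omega, ?_⟩
        have := ind1 t
        simp only [Finset.sum_range_one, add_zero, Set.indicator_of_mem ht, Pi.one_apply]
        linarith
      · simp only [B, Set.mem_ofPred_eq, not_forall, not_exists, not_and, not_le] at ht
        obtain ⟨n, h1, h2, h3⟩ := ht
        refine ⟨n, h1, by omega, ?_⟩
        have h4 := h3 _ (T.iter_mem_fiber t hx)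
        have h5 : ∑ i ∈ Finset.range n, (F j).indicator (1 : X → ℝ) (T.iter (t + i) ω x)
            = T.visits (F j) n (ϑ^[t] ω) (T.iter t ω x) :=
          Finset.sum_congr rfl fun i _ => by rw [iter_add]
        have h6 : 0 ≤ ∑ i ∈ Finset.range n, (B j).indicator (1 : Ω → ℝ) (ϑ^[t + i] ω) :=
          Finset.sum_nonneg fun i _ => ind0 _
        rw [Finset.sum_sub_distrib, Finset.sum_sub_distrib, h5]
        simp only [Finset.sum_const, Finset.card_range, nsmul_eq_mul]
        linarith) N
  rw [Finset.sum_sub_distrib, Finset.sum_sub_distrib] at key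
  simp only [Finset.sum_const, Finset.card_range, nsmul_eq_mul] at key
  have h7 := hj N (by omega)
  have h8 : (N₀ : ℝ) < N := by exact_mod_cast hN
  unfold baseVisits at h7
  push_cast at key
  change ∑ t ∈ Finset.range N, (F j).indicator (1 : X → ℝ) (T.iter t ω x) ≤ _
  have h9 : η * 3 = ε := by rw [hη]; ring
  nlinarith

end ContinuousBundleRDS

/-! ### Covers with small boundaries and the mean dimension -/

namespace ContinuousBundleRDS

lemma HasSBP.exists_finite_cover {Ω : Type*} [MeasurableSpace Ω] {P : Measure Ω}
    {ϑ : Ω → Ω} {X : Type*} [MetricSpace X] [CompactSpace X] [MeasurableSpace X]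
    {T : ContinuousBundleRDS P ϑ X} (hT : T.HasSBP) {α : Set (Set X)}
    (hα : IsFiniteOpenCover α) :
    ∃ (t : Finset X) (V a : X → Set X), (⋃ x ∈ t, V x = Set.univ) ∧
      ∀ x, a x ∈ α ∧ closure (V x) ⊆ a x ∧ T.IsSmall (frontier (V x)) := by
  have h : ∀ x : X, ∃ V a : Set X, V ∈ 𝓝 x ∧ a ∈ α ∧ closure V ⊆ a ∧
      T.IsSmall (frontier V) := by
    intro x
    obtain ⟨a, ha, hxa⟩ := Set.mem_sUnion.1 (hα.2.2.symm ▸ Set.mem_univ x : x ∈ ⋃₀ α)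
    obtain ⟨K, hK, hKc, hKa⟩ := exists_mem_nhds_isClosed_subset ((hα.2.1 a ha).mem_nhds hxa)
    obtain ⟨V, hV, hVK, hVs⟩ := hT x (interior K) isOpen_interior (mem_interior_iff_mem_nhds.2 hK)
    exact ⟨V, a, hV, ha,
      (closure_minimal (hVK.trans interior_subset) hKc).trans hKa, hVs⟩
  choose V a hV ha hVa hVs using h
  obtain ⟨t, ht⟩ := CompactSpace.elim_nhds_subcover V hV
  exact ⟨t, V, a, ht, fun x => ⟨ha x, hVa x, hVs x⟩⟩

/-- Urysohn functions of the pairs `V ⊆ a` which are fractional only in `O`, evaluated along an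
orbit segment, bound the dimension of the joined cover by the number of visits to the sets `O`. -/
lemma coverDim_joinCover_le {Ω : Type*} [MeasurableSpace Ω] {P : Measure Ω}
    {ϑ : Ω → Ω} {X : Type*} [MetricSpace X] [MeasurableSpace X]
    (T : ContinuousBundleRDS P ϑ X) {ω : Ω}
    (hω : ∀ n, ContinuousOn (T.iter n ω) (T.fiber ω)) {α : Set (Set X)}
    (hα : ∀ U ∈ α, IsOpen U) {t : Finset X} {V a O : X → Set X}
    (ht : ⋃ x ∈ t, V x = Set.univ) (ha : ∀ x, a x ∈ α) (hVa : ∀ x, closure (V x) ⊆ a x)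
    (hO : ∀ x ∈ t, IsOpen (O x)) (hVO : ∀ x ∈ t, frontier (V x) ⊆ O x) {N : ℕ} {c : ℝ}
    (hc : ∀ y ∈ T.fiber ω, ∑ v ∈ t, T.visits (O v) N ω y ≤ c) :
    coverDim (T.joinCover α N ω) ≤ (⌊c⌋₊ : ℕ) := by
  classical
  have hφ : ∀ v : t, ∃ φ : X → ℝ, Continuous φ ∧ (∀ x, 0 ≤ φ x ∧ φ x ≤ 1) ∧
      (∀ x ∈ V v, φ x = 1) ∧ (∀ x, 0 < φ x → x ∈ a v) ∧
      ∀ x, 0 < min (φ x) (1 - φ x) → x ∈ O v := by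
    intro v
    have hWo : IsOpen ((interior (V v) ∪ O v) ∩ a v) :=
      (isOpen_interior.union (hO v v.2)).inter (hα _ (ha v))
    have hsub : closure (V v) ⊆ (interior (V v) ∪ O v) ∩ a v := by
      refine Set.subset_inter ?_ (hVa v)
      rw [closure_eq_interior_union_frontier]
      exact Set.union_subset_union_right _ (hVO v v.2)
    obtain ⟨φ, h0, h1, h01⟩ := exists_continuous_zero_one_of_isClosed hWo.isClosed_compl
      isClosed_closure (Set.disjoint_left.2 fun x hx hx' => hx (hsub hx'))
    have hpos : ∀ x, 0 < φ x → x ∈ (interior (V v) ∪ O v) ∩ a v := by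
      intro x hx
      by_contra hcon
      exact hx.ne' (h0 hcon)
    refine ⟨φ, φ.continuous, fun x => ⟨(h01 x).1, (h01 x).2⟩, fun x hx => h1 (subset_closure hx),
      fun x hx => (hpos x hx).2, fun x hx => ?_⟩
    obtain ⟨hx0, hx1⟩ := lt_min_iff.1 hx
    refine (hpos x hx0).1.resolve_left fun hxV => ?_
    have := h1 (subset_closure (interior_subset hxV))
    simp only [Pi.one_apply] at this
    linarith
  choose φ hφc hφ01 hφ1 hφa hφO using hφ
  have hcont : ∀ n, Continuous fun y : T.fiber ω => T.iter n ω y := fun n =>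
    continuousOn_iff_continuous_domRestrict.1 (hω n)
  refine coverDim_le_of_skeleton (C := Fin N × t)
    (g := fun c (y : T.fiber ω) => φ c.2 (T.iter c.1 ω (y : X)))
    (fun c => (hφc c.2).comp (hcont c.1))
    (fun c y => (hφ01 _ _).1) (fun c y => (hφ01 _ _).2) (fun y => ?_) (fun D hD => ?_)
  · have hcard : (((Finset.univ.filter fun c : Fin N × t =>
        0 < min (φ c.2 (T.iter c.1 ω (y : X))) (1 - φ c.2 (T.iter c.1 ω (y : X)))).card : ℕ) : ℝ)
        ≤ ∑ v ∈ t, T.visits (O v) N ω y := by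
      rw [Finset.card_filter, ← Finset.univ_product_univ, Finset.sum_product_right,
        ← Finset.sum_coe_sort t]
      push_cast
      refine Finset.sum_le_sum fun v _ => ?_
      rw [visits, ← Fin.sum_univ_eq_sum_range
        (fun i => (O v).indicator (1 : X → ℝ) (T.iter i ω y))]
      refine Finset.sum_le_sum fun i _ => ?_
      split_ifs with h
      · rw [Set.indicator_of_mem (hφO _ _ h)]; rfl
      · exact Set.indicator_nonneg (fun _ _ => zero_le_one) _
    exact Nat.le_floor (hcard.trans (hc y y.2))
  · obtain ⟨y, hy⟩ := hD
    have hv : ∀ i : Fin N, ∃ v : t, T.iter i ω (y : X) ∈ V v := by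
      intro i
      have := ht.symm ▸ Set.mem_univ (T.iter i ω (y : X))
      simp only [Set.mem_iUnion] at this
      obtain ⟨v, hv, h⟩ := this
      exact ⟨⟨v, hv⟩, h⟩
    choose v hv using hv
    exact ⟨_, ⟨fun i => a (v i), fun i => ha _, rfl⟩, fun z hz i =>
      hφa _ _ (hz (i, v i) (hy (i, v i) (hφ1 _ _ (hv i))))⟩

/-- Almost surely, the dimensions of all the joined covers grow at most linearly, at a
deterministic rate. -/
lemma HasSBP.exists_ae_coverDim_le_mul {Ω : Type*} [MeasurableSpace Ω] {P : Measure Ω}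
    {ϑ : Ω → Ω} (hϑ : MeasurePreserving ϑ P P) {X : Type*} [MetricSpace X] [CompactSpace X]
    [MeasurableSpace X] {T : ContinuousBundleRDS P ϑ X} (hT : T.HasSBP) {α : Set (Set X)}
    (hα : IsFiniteOpenCover α) :
    ∃ K : ℕ, ∀ᵐ ω ∂P, ∀ N : ℕ, coverDim (T.joinCover α N ω) ≤ (K * N : ℕ) := by
  obtain ⟨t, V, a, ht, hV⟩ := hT.exists_finite_cover hα
  refine ⟨t.card, ?_⟩
  filter_upwards [T.ae_continuousOn_iter hϑ] with ω hω N
  have := T.coverDim_joinCover_le (O := fun _ => Set.univ) (N := N) (c := (t.card * N : ℕ))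
    hω hα.2.1 ht (fun x => (hV x).1) (fun x => (hV x).2.1) (fun _ _ => isOpen_univ)
    (fun _ _ => Set.subset_univ _) fun y _ => by simp [visits]
  rwa [Nat.floor_natCast] at this

lemma HasSBP.ae_exists_coverDim_le {Ω : Type*} [MeasurableSpace Ω] {P : Measure Ω}
    [IsProbabilityMeasure P] [P.IsComplete] {ϑ : Ω → Ω} (hϑ : MeasurePreserving ϑ P P)
    {X : Type*} [MetricSpace X] [CompactSpace X] [MeasurableSpace X] [BorelSpace X]
    {T : ContinuousBundleRDS P ϑ X} (hT : T.HasSBP) {α : Set (Set X)}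
    (hα : IsFiniteOpenCover α) {ε : ℝ} (hε : 0 < ε) :
    ∀ᵐ ω ∂P, ∃ N₀ : ℕ, ∀ N : ℕ, N₀ < N →
      ((coverDim (T.joinCover α N ω) : ℕ∞) : ℝ≥0∞) ≤ ENNReal.ofReal (ε * N) := by
  obtain ⟨t, V, a, ht, hV⟩ := hT.exists_finite_cover hα
  have hη : 0 < ε / (t.card + 1) := by positivity
  have hsmall : ∀ᵐ ω ∂P, ∀ v ∈ t, ∃ δ > 0, ∃ N₀ : ℕ, ∀ N : ℕ, N₀ < N → ∀ x ∈ T.fiber ω,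
      T.visits (Metric.cthickening δ (frontier (V v))) N ω x ≤ ε / (t.card + 1) * N :=
    (ae_ball_iff t.countable_toSet).2 fun v _ =>
      T.ae_exists_visits_cthickening_le hϑ isClosed_frontier (hV v).2.2 hη
  filter_upwards [hsmall, T.ae_continuousOn_iter hϑ] with ω h hω
  choose! δ hδ N₀ hN₀ using h
  refine ⟨t.sup N₀, fun N hN => ?_⟩
  have hle : coverDim (T.joinCover α N ω) ≤ (⌊ε * N⌋₊ : ℕ) := by
    refine T.coverDim_joinCover_le (O := fun v => Metric.thickening (δ v) (frontier (V v)))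
      hω hα.2.1 ht (fun x => (hV x).1) (fun x => (hV x).2.1)
      (fun _ _ => Metric.isOpen_thickening)
      (fun v hv => Metric.self_subset_thickening (hδ v hv) _) fun y hy => ?_
    calc _ ≤ ∑ v ∈ t, ε / (t.card + 1) * N := Finset.sum_le_sum fun v hv =>
          (T.visits_mono (Metric.thickening_subset_cthickening _ _) _ _ _).trans
            (hN₀ v hv N ((Finset.le_sup hv).trans_lt hN) y hy)
      _ = ε * N * (t.card / (t.card + 1)) := by
          rw [Finset.sum_const, nsmul_eq_mul]; ring
      _ ≤ ε * N * 1 := by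
          gcongr
          exact (div_le_one (by positivity)).2 (by linarith)
      _ = ε * N := mul_one _
  calc ((coverDim (T.joinCover α N ω) : ℕ∞) : ℝ≥0∞) ≤ (((⌊ε * N⌋₊ : ℕ) : ℕ∞) : ℝ≥0∞) :=
        ENat.toENNReal_le.2 hle
    _ = ENNReal.ofReal (⌊ε * N⌋₊ : ℕ) := by simp
    _ ≤ ENNReal.ofReal (ε * N) := ENNReal.ofReal_le_ofReal (Nat.floor_le (by positivity))

/-- Dominated convergence, from the almost sure linear bound and the almost sure sublinear growth.
Measurable minorants with the same lower integrals are used, so that the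
measurability of `ω ↦ 𝒟(α_0^{n-1}(ω))` is not needed. -/
lemma HasSBP.mdimCover_eq_zero {Ω : Type*} [MeasurableSpace Ω] {P : Measure Ω}
    [IsProbabilityMeasure P] [P.IsComplete] {ϑ : Ω → Ω} (hϑ : MeasurePreserving ϑ P P)
    {X : Type*} [MetricSpace X] [CompactSpace X] [MeasurableSpace X] [BorelSpace X]
    {T : ContinuousBundleRDS P ϑ X} (hT : T.HasSBP) {α : Set (Set X)}
    (hα : IsFiniteOpenCover α) : T.mdimCover α = 0 := by
  obtain ⟨K, hK⟩ := hT.exists_ae_coverDim_le_mul hϑ hα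
  have hsmall : ∀ᵐ ω ∂P, ∀ m : ℕ, ∃ N₀ : ℕ, ∀ N : ℕ, N₀ < N →
      ((coverDim (T.joinCover α N ω) : ℕ∞) : ℝ≥0∞)
        ≤ ENNReal.ofReal (1 / ((m : ℝ) + 1) * N) :=
    ae_all_iff.2 fun m => hT.ae_exists_coverDim_le hϑ hα (by positivity)
  choose G hGm hGle hGeq using fun n : ℕ => exists_measurable_le_lintegral_eq P
    fun ω => ((coverDim (T.joinCover α n ω) : ℕ∞) : ℝ≥0∞)
  have hlim : Tendsto (fun n : ℕ => ∫⁻ ω, G n ω / n ∂P) atTop (𝓝 (∫⁻ _, 0 ∂P)) := by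
    refine tendsto_lintegral_of_dominated_convergence (fun _ => (K : ℝ≥0∞))
      (fun n => (hGm n).div_const _) (fun n => ?_) (by simp) ?_
    · filter_upwards [hK] with ω hω
      refine ENNReal.div_le_of_le_mul ((hGle n ω).trans ?_)
      exact (ENat.toENNReal_le.2 (hω n)).trans (by simp)
    · filter_upwards [hsmall] with ω hω
      have hbound : ∀ m : ℕ, ∀ᶠ n : ℕ in atTop,
          G n ω / n ≤ ENNReal.ofReal (1 / ((m : ℝ) + 1)) := by
        intro m
        obtain ⟨N₀, hN₀⟩ := hω m
        filter_upwards [eventually_gt_atTop N₀] with n hn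
        refine ENNReal.div_le_of_le_mul ((hGle n ω).trans ((hN₀ n hn).trans ?_))
        rw [ENNReal.ofReal_mul (by positivity), ENNReal.ofReal_natCast]
      have hm : Tendsto (fun j : ℕ => ENNReal.ofReal (1 / ((j : ℝ) + 1))) atTop (𝓝 0) := by
        simpa using ENNReal.tendsto_ofReal tendsto_one_div_add_atTop_nhds_zero_nat
      rw [ENNReal.tendsto_nhds_zero]
      intro η hη
      obtain ⟨m, hmη⟩ := (hm.eventually_lt_const hη).exists
      exact (hbound m).mono fun n hn => hn.trans hmη.le
  have hdiv : ∀ n : ℕ, ∫⁻ ω, G n ω / n ∂P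
      = (∫⁻ ω, ((coverDim (T.joinCover α n ω) : ℕ∞) : ℝ≥0∞) ∂P) / (n : ℝ≥0∞) := by
    intro n
    simp only [div_eq_mul_inv]
    rw [lintegral_mul_const _ (hGm n), ← hGeq n]
  simp only [hdiv, lintegral_zero] at hlim
  exact hlim.limsup_eq

end ContinuousBundleRDS

theorem mainTheorem1 {Ω : Type*} [MeasurableSpace Ω] (P : Measure Ω) [IsProbabilityMeasure P]
    [P.IsComplete] (ϑ : Ω → Ω) (hϑ : MeasurePreserving ϑ P P)
    {X : Type*} [MetricSpace X] [CompactSpace X] [MeasurableSpace X] [BorelSpace X]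
    (T : ContinuousBundleRDS P ϑ X) (hT : T.HasSBP) :
    T.mdim = 0 ∧
      ∀ α : Set (Set X), IsFiniteOpenCover α → ∀ ε : ℝ, 0 < ε →
        ∀ᵐ ω ∂P, ∃ N₀ : ℕ, ∀ N : ℕ, N₀ < N →
          ((coverDim (T.joinCover α N ω) : ℕ∞) : ℝ≥0∞)
            < ENNReal.ofReal (ε * (α.ncard : ℝ) * (N : ℝ)) := by
  refine ⟨?_, fun α hα ε hε => ?_⟩
  · simp only [ContinuousBundleRDS.mdim, ENNReal.iSup_eq_zero]
    exact fun α hα => hT.mdimCover_eq_zero hϑ hα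
  · filter_upwards [hT.ae_exists_coverDim_le hϑ hα (half_pos hε)] with ω ⟨N₀, hN₀⟩
    refine ⟨N₀, fun N hN => (hN₀ N hN).trans_lt ?_⟩
    have hN0 : (0 : ℝ) < N := by exact_mod_cast (Nat.zero_le N₀).trans_lt hN
    -- The fibre over `ω` is nonempty, and so is the cover `α`.
    have hcard : (1 : ℝ) ≤ α.ncard := by
      obtain ⟨x, -⟩ := T.nonempty_fiber ω
      obtain ⟨a, ha, -⟩ := Set.mem_sUnion.1 (hα.2.2.symm ▸ Set.mem_univ x : x ∈ ⋃₀ α)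
      exact_mod_cast (Set.ncard_pos hα.1).2 ⟨a, ha⟩
    refine (ENNReal.ofReal_lt_ofReal_iff (by positivity)).2 ?_
    calc ε / 2 * N < ε * 1 * N := by nlinarith [mul_pos hε hN0]
      _ ≤ ε * α.ncard * N := by gcongr
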